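/- **Model.** A platform has $n$ opportunities with capacities $c_i\in\{1,2,\dots\}$ and may show rankings (ordered lists of distinct opportunities, possibly empty) of length at most $K$. A finite sequence of volunteers $t=1,\dots,T$ arrives, and each volunteer's type is observed only upon arrival. An *external* volunteer $t$ has a target $i^*_t$ and signs up for it with probability one, whatever the platform does. An *internal* volunteer $t$ has conversion probabilities $\mu_{i,t}\in[0,1]$ and follows the Opportunity-Agnostic Cascade Model with view probability $\nu_t\in(0,1]$ and exit probability $q_t\in[0,1]$: shown a ranking, the volunteer examines it from the top; the examined opportunity is viewed with probability $\nu_t$; if opportunity $i$ is viewed, the volunteer signs up for it with probability $\mu_{i,t}$ and leaves in any case; if it is not viewed, the volunteer exits with probability $q_t$ and otherwise moves to the next position (leaving at the end of the list). All these random choices are independent. Let $\phi_{i,t}(\vec S)$ denote the probability that volunteer $t$ signs up for $i$ when shown $\vec S$. The value $\pi(\mathcal I)$ of an algorithm $\pi$ on an instance $\mathcal I$ is the expectation of $\sum_i\min\{c_i,\#\text{sign-ups for } i\}$. $\mathrm{OPT}(\mathcal I)$ is the maximum value over all recommendation policies that know the whole arrival sequence in advance but see sign-up decisions only as they occur. **Algorithm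 AC-R.** Let $\psi(x)=1-e^{x-1}$. Keep counters $E_i$ and $N_i$ of the capacity of $i$ filled so far by external and by internal traffic (sign-ups for an opportunity with $E_i+N_i=c_i$ are not counted). The fill rate is $\mathrm{FR}_i=N_i/(c_i-E_i)$, with $\mathrm{FR}_i=1$ if $E_i=c_i$. To each internal volunteer $t$, AC-R shows a ranking $\vec S$ that maximizes $\sum_i\phi_{i,t}(\vec S)\,\psi(\mathrm{FR}_i)$ (current fill rates; ties broken in any way). **Parameters.** The effective fraction of external traffic of $\mathcal I$ is $\beta(\mathcal I)=\sum_i\min\{c_i,\#\{t \text{ external}: i^*_t=i\}\}\big/\sum_i c_i$; the smallest capacity is $\underline c=\min_i c_i$; the maximum conversion probability ratio (MCPR) is $\max_t \frac{\max_{i\in\mathcal S_t}\mu_{i,t}}{\min_{i\in\mathcal S_t}\mu_{i,t}}$ with $\mathcal S_t=\{i:\mu_{i,t}>0\}$, where for external $t$ one puts $\mu_{i^*_t,t}=1$ and $\mu_{i,t}=0$ otherwise, and volunteers with $\mathcal S_t=\emptyset$ are ignored. **Bound.** Let $\mathcal D=\{x\in\mathbb R^2_{\ge0}: x_1+x_2\le1\}$,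 $$g(x_1,x_2)=1-\tfrac1e+x_1+(1-x_1)\,\psi\!\left(\tfrac{x_2}{1-x_1}\right)-\psi(x_2),$$ where the product $(1-x_1)\psi(x_2/(1-x_1))$ is read as $0$ at $x_1=1$, and let $\breve g$ be the lower convex envelope of $g$ over $\mathcal D$, i.e. the supremum of all convex functions on $\mathcal D$ that are at most $g$ on $\mathcal D$. Let $f(\beta,\underline c,\sigma)=\max\{\beta,z^*\}$, where $z^*$ is the infimum of all $z\in[0,1]$ with $$z\ge e^{-1/\underline c}(1-1/e)\quad\text{and}\quad z\ge e^{-1/\underline c}\,\breve g\big(\max\{0,\beta-\sigma+z\},\,z-\max\{0,\beta-\sigma+z\}\big).$$ **Proposition.** For all $\beta$, $\underline c$ and $\sigma$, the competitive ratio of AC-R under the Opportunity-Agnostic Cascade Model is at least $f(\beta,\underline c,\sigma)$: for every instance $\mathcal I$ as above with effective fraction of external traffic $\beta$, smallest capacity $\underline c$, MCPR at most $\sigma$ and $\mathrm{OPT}(\mathcal I)>0$, $$\frac{\text{AC-R}(\mathcal I)}{\mathrm{OPT}(\mathcal I)}\;\ge\; f(\beta,\underline c,\sigma).$$ -/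

import Mathlib

open scoped BigOperators

noncomputable section

namespace CascadeRanking

/-- The type of an internal volunteer following the opportunity-agnostic cascade model:
conversion probabilities `μ`, view probability `ν` and exit probability `q`. -/
structure InternalType (n : ℕ) where
  μ : Fin n → ℝ
  ν : ℝ
  q : ℝ
  μ_nonneg : ∀ i, 0 ≤ μ i
  μ_le_one : ∀ i, μ i ≤ 1
  ν_pos : 0 < ν
  ν_le_one : ν ≤ 1
  q_nonneg : 0 ≤ q
  q_le_one : q ≤ 1

/-- A volunteer is either external traffic with a targeted opportunity, or internal traffic. -/
inductive Volunteer (n : ℕ) where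
  | external (target : Fin n) : Volunteer n
  | internal (v : InternalType n) : Volunteer n

/-- The conversion probabilities of a volunteer. External traffic signs up for its target with
probability one and can sign up for nothing else. -/
def Volunteer.μ {n : ℕ} : Volunteer n → Fin n → ℝ
  | .external j, i => if i = j then 1 else 0
  | .internal v, i => v.μ i

/-- The law of the sign-up decision (`none` means no sign-up) of an internal volunteer who is
shown a ranked list. The volunteer views the top-ranked opportunity `i` with probability `ν`, and
then signs up for it with probability `μ i` and leaves. If the opportunity is not viewed, the
volunteer exits with probability `q` and otherwise moves on to the rest of the list. -/
def InternalType.signUpProb {n : ℕ} (v : InternalType n) :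
    List (Fin n) → Option (Fin n) → ℝ
  | [], o => if o = none then 1 else 0
  | i :: S, o =>
      v.ν * (if o = some i then v.μ i else if o = none then 1 - v.μ i else 0)
        + (1 - v.ν) * (v.q * (if o = none then 1 else 0) + (1 - v.q) * v.signUpProb S o)

/-- The law of the sign-up decision of an arbitrary volunteer. External traffic
signs up for its target, whatever the platform does. -/
def Volunteer.signUpProb {n : ℕ} : Volunteer n → List (Fin n) → Option (Fin n) → ℝ
  | .external j, _, o => if o = some j then 1 else 0
  | .internal v, S, o => v.signUpProb S o

/-- The data known to the platform in advance: the opportunities, their (positive) capacities and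
the maximal length `K` of a ranking. -/
structure Platform where
  n : ℕ
  cap : Fin n → ℕ
  cap_pos : ∀ i, 0 < cap i
  K : ℕ

/-- Ranked subsets of the opportunities of length at most `K`. The empty ranking
stands for recommending nothing. -/
def Platform.Ranking (P : Platform) : Type :=
  {S : List (Fin P.n) // S.Nodup ∧ S.length ≤ P.K}

/-- The past arrivals with their sign-up decisions, most recent first. -/
abbrev Platform.History (P : Platform) : Type :=
  List (Volunteer P.n × Option (Fin P.n))

/-- A recommendation policy: it picks a ranking on the basis of the history and of the type of the
volunteer that has just arrived. -/
abbrev Platform.Policy (P : Platform) : Type :=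
  P.History → Volunteer P.n → P.Ranking

/-- The filled capacity at the end of the horizon; sign-ups beyond capacity have no value. -/
def Platform.filled (P : Platform) (h : P.History) : ℝ :=
  ∑ i, ((min (P.cap i) ((h.map Prod.snd).count (some i)) : ℕ) : ℝ)

/-- The expected filled capacity at the end of the horizon under policy `π`, given the history `h`
and the sequence of volunteers still to come. -/
def Platform.expValue (P : Platform) (π : P.Policy) :
    P.History → List (Volunteer P.n) → ℝ
  | h, [] => P.filled h
  | h, v :: L => ∑ o, v.signUpProb (π h v).1 o * P.expValue π ((v, o) :: h) L

/-- A problem instance: a platform together with a finite sequence of arriving volunteers. -/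
structure Instance extends Platform where
  arrivals : List (Volunteer n)

/-- An online algorithm is a policy that does not depend on the sequence of arrivals. -/
abbrev OnlineAlgorithm : Type := (P : Platform) → P.Policy

/-- The expected value of an online algorithm on an instance. -/
def OnlineAlgorithm.value (alg : OnlineAlgorithm) (I : Instance) : ℝ :=
  I.toPlatform.expValue (alg I.toPlatform) [] I.arrivals

/-- The expected value of the optimal clairvoyant algorithm: the best policy
for the given, fully known sequence of arrivals. Decisions are only observed as they are made. -/
def Instance.opt (I : Instance) : ℝ :=
  ⨆ π : I.toPlatform.Policy, I.toPlatform.expValue π [] I.arrivals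

/-- Number of external arrivals that target opportunity `i`. -/
def Instance.extArrivals (I : Instance) (i : Fin I.n) : ℕ :=
  I.arrivals.countP fun v => match v with
    | .external j => decide (j = i)
    | .internal _ => false

/-- The effective fraction of external traffic. -/
def Instance.efet (I : Instance) : ℝ :=
  (∑ i, ((min (I.cap i) (I.extArrivals i) : ℕ) : ℝ)) / ∑ i, (I.cap i : ℝ)

/-- The smallest capacity. -/
def Instance.minCap (I : Instance) : ℕ := ⨅ i, I.cap i

/-- The conversion probability ratio of a volunteer, over the opportunities for which the
conversion probability is positive. It is `0` for a volunteer who never signs up. -/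
def Volunteer.cpr {n : ℕ} (v : Volunteer n) : ℝ :=
  (⨆ i : {i : Fin n // 0 < v.μ i}, v.μ i) / ⨅ i : {i : Fin n // 0 < v.μ i}, v.μ i

/-- The maximum conversion probability ratio. -/
def Instance.mcpr (I : Instance) : ℝ :=
  ⨆ t : Fin I.arrivals.length, (I.arrivals.get t).cpr

/-- The trade-off function. -/
def psi (x : ℝ) : ℝ := 1 - Real.exp (x - 1)

/-- For every opportunity, the capacity filled so far by external traffic (first component) and by
internal traffic (second component). -/
def Platform.counters (P : Platform) : P.History → Fin P.n → ℕ × ℕ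
  | [], _ => (0, 0)
  | (v, o) :: h, i =>
      let a := P.counters h i
      if o = some i then
        match v with
        | .external _ => (min (P.cap i - a.2) (a.1 + 1), a.2)
        | .internal _ => (a.1, min (P.cap i - a.1) (a.2 + 1))
      else a

/-- The fill rate: capacity filled by internal traffic over the capacity not filled by external
traffic. An opportunity filled by external traffic alone has fill rate `1`. -/
def Platform.fillRate (P : Platform) (h : P.History) (i : Fin P.n) : ℝ :=
  if (P.counters h i).1 = P.cap i then 1
  else ((P.counters h i).2 : ℝ) / ((P.cap i : ℝ) - ((P.counters h i).1 : ℝ))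

/-- The quantity that the adaptive capacity algorithm maximizes over rankings. -/
def Platform.acrObjective (P : Platform) (h : P.History) (v : InternalType P.n)
    (S : P.Ranking) : ℝ :=
  ∑ i, v.signUpProb S.1 (some i) * psi (P.fillRate h i)

/-- `alg` is the adaptive capacity algorithm for rankings, under some tie-breaking rule: to every
internal volunteer it shows a ranking that maximizes the objective. -/
def IsACR (alg : OnlineAlgorithm) : Prop :=
  ∀ (P : Platform) (h : P.History) (v : InternalType P.n) (S : P.Ranking),
    P.acrObjective h v S ≤ P.acrObjective h v (alg P h (.internal v))

/-- The competitive ratio over a class of instances. As usual, only instances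
on which the benchmark is positive are considered; the infimum over no instance is `⊤`. -/
def compRatio (alg : OnlineAlgorithm) (C : Set Instance) : EReal :=
  ⨅ (I : Instance) (_ : I ∈ C) (_ : 0 < I.opt), ((alg.value I / I.opt : ℝ) : EReal)

/-- Instances with given effective fraction of external traffic and smallest capacity, and with
maximum conversion probability ratio at most `σ`. -/
def instanceClass (β : ℝ) (c : ℕ) (σ : ℝ) : Set Instance :=
  {I | I.efet = β ∧ I.minCap = c ∧ I.mcpr ≤ σ}

/-- The triangle on which the convex envelope is taken. -/
def triangle : Set (ℝ × ℝ) := {x | 0 ≤ x.1 ∧ 0 ≤ x.2 ∧ x.1 + x.2 ≤ 1}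

def g (x : ℝ × ℝ) : ℝ :=
  1 - 1 / Real.exp 1 + x.1 + (1 - x.1) * psi (x.2 / (1 - x.1)) - psi x.2

/-- The lower convex envelope of `f` over `D`: the supremum of all convex
functions that are at most `f` on `D`. -/
def lowerConvexEnvelope (D : Set (ℝ × ℝ)) (f : ℝ × ℝ → ℝ) (x : ℝ × ℝ) : ℝ :=
  sSup {y | ∃ k : ℝ × ℝ → ℝ, ConvexOn ℝ D k ∧ (∀ p ∈ D, k p ≤ f p) ∧ y = k x}

/-- The optimal value of the one-dimensional program that defines the bound. -/
def zStar (β : ℝ) (c : ℕ) (σ : ℝ) : ℝ :=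
  sInf {z | z ∈ Set.Icc (0 : ℝ) 1 ∧
    Real.exp (-1 / (c : ℝ)) * (1 - 1 / Real.exp 1) ≤ z ∧
    Real.exp (-1 / (c : ℝ)) *
      lowerConvexEnvelope triangle g (max 0 (β - σ + z), z - max 0 (β - σ + z)) ≤ z}

def bound (β : ℝ) (c : ℕ) (σ : ℝ) : ℝ := max β (zStar β c σ)

end CascadeRanking

end

open scoped BigOperators

noncomputable section

namespace CascadeRanking

/-! ### The trade-off functions -/

/-! Write `z` for the ratio AC-R/OPT and `γ` for `exp (-1 / c)` with `c` the smallest capacity. The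
bound `β ≤ z` is immediate: external traffic signs up under every policy, and OPT is at most the
total capacity. For `zStar` it suffices that `z` itself is feasible in the program. The envelope
constraint only has to be tested against affine minorants `α + a x₁ + b x₂` of `g`, because a convex
function below `g` has a supporting affine function at every interior point. Since `g` decreases in
`x₂` and is smallest on the edge `x₁ = 0`, one may take `a ≥ 0 ≥ b`.

Fix such a minorant and put `λ = γ (a - b)`. Run AC-R and an arbitrary policy independently on the
same arrivals. An internal sign-up of AC-R earns `max (ψ(FR) - λ) 0`; one of the other policy earns
`ψ(FR) - λ σ`, evaluated at the fill rates of AC-R. The difference of the two totals is a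
submartingale (`potential_le_step`). The heart of this is the exchange argument behind
`cascadeSum_truncate_le`: a ranking that is optimal for some weights is also optimal for their
excess over any common level. With the level `λ max μ`, the MCPR accounts for the gap between `λ`
and `λ σ`.

At the end of the horizon, the internal sign-ups made when `ψ(FR) ≤ λ` are booked as if they were
external. Each opportunity then gives a point of the triangle at which the minorant of `g` applies
(`affine_le_of_minorant`); the factor `γ` pays for the integrality of capacities. Taking
expectations yields an inequality that is affine in both values (`key_inequality`), and
`affine_le_ratio` turns it into the constraint at `(β - σ + z, σ - β)`. -/

lemma psi_antitone : Antitone psi := fun x y h => by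
  unfold psi
  have := Real.exp_le_exp.2 (sub_le_sub_right h 1)
  linarith

lemma psi_one : psi 1 = 0 := by simp [psi]

lemma psi_zero : psi 0 = 1 - 1 / Real.exp 1 := by simp [psi, Real.exp_neg]

lemma psi_nonneg {x : ℝ} (h : x ≤ 1) : 0 ≤ psi x := psi_one ▸ psi_antitone h

lemma psi_le {x : ℝ} (h : 0 ≤ x) : psi x ≤ 1 - 1 / Real.exp 1 := psi_zero ▸ psi_antitone h

lemma g_eq (x : ℝ × ℝ) :
    g x = 1 - 1 / Real.exp 1 + Real.exp (x.2 - 1)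
      - (1 - x.1) * Real.exp (x.2 / (1 - x.1) - 1) := by
  unfold g psi
  ring

lemma exp_zero_sub_one : Real.exp (0 - 1) = 1 / Real.exp 1 := by simp [Real.exp_neg]

lemma g_zero_left (x : ℝ) : g (0, x) = 1 - 1 / Real.exp 1 := by
  simp [g_eq]

lemma antitoneOn_exp_sub_perspective {s : ℝ} (hs : 0 < s) (hs1 : s ≤ 1) :
    AntitoneOn (fun x : ℝ => Real.exp (x - 1) - s * Real.exp (x / s - 1)) (Set.Ici 0) := by
  have hd : ∀ x : ℝ, HasDerivAt (fun x : ℝ => Real.exp (x - 1) - s * Real.exp (x / s - 1))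
      (Real.exp (x - 1) - Real.exp (x / s - 1)) x := by
    intro x
    have h1 := ((hasDerivAt_id x).sub_const 1).exp
    have h2 := ((((hasDerivAt_id x).div_const s).sub_const 1).exp).const_mul s
    refine (h1.sub h2).congr_deriv ?_
    simp only [id, mul_one]
    field_simp
  refine antitoneOn_of_deriv_nonpos (convex_Ici 0)
    (fun x _ => (hd x).continuousAt.continuousWithinAt)
    (fun x _ => (hd x).differentiableAt.differentiableWithinAt) fun x hx => ?_
  rw [interior_Ici] at hx
  rw [(hd x).deriv, sub_nonpos, Real.exp_le_exp]
  have : x ≤ x / s := by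
    rw [le_div_iff₀ hs]
    exact mul_le_of_le_one_right (le_of_lt hx) hs1
  linarith

lemma g_antitone_right {x₁ x₂ y₂ : ℝ} (h1 : 0 ≤ x₁) (h2 : 0 ≤ x₂) (h : x₂ ≤ y₂)
    (hy : x₁ + y₂ ≤ 1) : g (x₁, y₂) ≤ g (x₁, x₂) := by
  rcases h.eq_or_lt with rfl | hlt
  · exact le_rfl
  have hs : 0 < 1 - x₁ := by linarith
  have := antitoneOn_exp_sub_perspective hs (by linarith) (Set.mem_Ici.2 h2)
    (Set.mem_Ici.2 (h2.trans h)) h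
  simp only [g_eq]
  simp only at this
  linarith

/-- By monotonicity in `x₂` it is enough to look at the hypotenuse, where the claim is `exp (-x₁) ≥
1 - x₁`. -/
lemma le_g {x : ℝ × ℝ} (hx : x ∈ triangle) : 1 - 1 / Real.exp 1 ≤ g x := by
  obtain ⟨h1, h2, h3⟩ := hx
  refine le_trans ?_ (g_antitone_right (y₂ := 1 - x.1) h1 h2 (by linarith) (by linarith))
  rw [g_eq]
  rcases (show 0 ≤ 1 - x.1 by linarith).eq_or_lt with hs | hs
  · simp only [← hs]
    rw [zero_mul, sub_zero]
    exact le_add_of_nonneg_right (Real.exp_pos _).le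
  · have := Real.add_one_le_exp (1 - x.1 - 1)
    simp only [div_self hs.ne', sub_self, Real.exp_zero]
    linarith

lemma g_le_one {x : ℝ × ℝ} (hx : x ∈ triangle) : g x ≤ 1 := by
  obtain ⟨h1, h2, h3⟩ := hx
  refine (g_antitone_right (x₁ := x.1) (x₂ := 0) (y₂ := x.2) h1 le_rfl h2 h3).trans ?_
  rw [g_eq]
  simp only [zero_div, exp_zero_sub_one]
  have : 0 ≤ (1 - x.1) * (1 / Real.exp 1) := by
    have := Real.exp_pos 1
    have : 0 ≤ 1 - x.1 := by linarith
    positivity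
  linarith

/-- The perspective `s * exp (m / s - 1)` is convex and homogeneous, hence subadditive; the added
pair `(w, w)` contributes `w * exp 0`. This is what allows `w` internal sign-ups to be booked as
external. -/
lemma perspective_exp_le {s m w : ℝ} (hm : 0 ≤ m) (hms : m ≤ s)
    (hw : 0 ≤ w) :
    (s + w) * Real.exp ((m + w) / (s + w) - 1) ≤ s * Real.exp (m / s - 1) + w := by
  rcases (hm.trans hms).eq_or_lt with rfl | hs
  · have : m = 0 := le_antisymm hms hm
    subst this
    rcases hw.eq_or_lt with rfl | hw
    · simp
    · simp [div_self hw.ne']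
  · have hsw : 0 < s + w := by linarith
    have := convexOn_exp.2 (Set.mem_univ (m / s - 1)) (Set.mem_univ 0)
      (div_nonneg hs.le hsw.le) (div_nonneg hw hsw.le) (by field_simp)
    simp only [smul_eq_mul, mul_zero, add_zero, Real.exp_zero, mul_one] at this
    have h1 : s / (s + w) * (m / s - 1) = (m + w) / (s + w) - 1 := by
      field_simp
      ring
    rw [h1] at this
    have h2 := mul_le_mul_of_nonneg_left this hsw.le
    have h3 : (s + w) * (s / (s + w) * Real.exp (m / s - 1) + w / (s + w))
        = s * Real.exp (m / s - 1) + w := by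
      field_simp
    linarith

/-! ### Affine minorants -/

/-- A convex function on the triangle has a supporting affine function at every interior point. -/
lemma exists_affine_minorant {k : ℝ × ℝ → ℝ} (hk : ConvexOn ℝ triangle k) {y : ℝ × ℝ}
    (h1 : 0 < y.1) (h2 : 0 < y.2) (h3 : y.1 + y.2 < 1) :
    ∃ α a b : ℝ, (∀ p ∈ triangle, α + a * p.1 + b * p.2 ≤ k p) ∧
      k y = α + a * y.1 + b * y.2 := by
  set U : Set (ℝ × ℝ) := {x | 0 < x.1 ∧ 0 < x.2 ∧ x.1 + x.2 < 1} with hU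
  have hUo : IsOpen U := by
    refine (isOpen_lt continuous_const continuous_fst).inter
      ((isOpen_lt continuous_const continuous_snd).inter
        (isOpen_lt (continuous_fst.add continuous_snd) continuous_const))
  have hUT : U ⊆ triangle := fun x hx => ⟨hx.1.le, hx.2.1.le, hx.2.2.le⟩
  have hUc : Convex ℝ U := by
    rintro ⟨x1, x2⟩ ⟨hx1, hx2, hx3⟩ ⟨z1, z2⟩ ⟨hz1, hz2, hz3⟩ s t hs ht hst
    simp only at hx1 hx2 hx3 hz1 hz2 hz3
    simp only [hU, Prod.smul_mk, smul_eq_mul, Prod.mk_add_mk, Set.mem_ofPred_eq]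
    rcases hs.eq_or_lt with rfl | hs'
    · have : t = 1 := by linarith
      subst this
      simp [hz1, hz2, hz3]
    · refine ⟨by positivity, by positivity, ?_⟩
      nlinarith
  have hkU : ConvexOn ℝ U k := hk.subset hUT hUc
  have hcont : ContinuousOn k U := hkU.continuousOn hUo
  set epi : Set ((ℝ × ℝ) × ℝ) := {p | p.1 ∈ U ∧ k p.1 < p.2} with hepi
  have hec : Convex ℝ epi := hkU.convex_strict_epigraph
  have heo : IsOpen epi := by
    have hc : ContinuousOn (fun p : (ℝ × ℝ) × ℝ => p.2 - k p.1) (U ×ˢ Set.univ) :=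
      continuousOn_snd.sub (hcont.comp continuousOn_fst fun p hp => hp.1)
    have := hc.isOpen_inter_preimage (hUo.prod isOpen_univ) (isOpen_Ioi (a := (0 : ℝ)))
    convert this using 1
    ext p
    simp [hepi, sub_pos]
  have hyU : y ∈ U := ⟨h1, h2, h3⟩
  obtain ⟨f, hf⟩ := geometric_hahn_banach_point_open (x := (y, k y)) hec heo
    (fun h => lt_irrefl _ h.2)
  set τ := f ((0, 0), 1) with hτ
  set A := f ((1, 0), 0) with hA
  set B := f ((0, 1), 0) with hB
  have hdec : ∀ p : ℝ × ℝ, ∀ t : ℝ, f (p, t) = p.1 * A + p.2 * B + t * τ := by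
    rintro ⟨p1, p2⟩ t
    have : (((p1, p2), t) : (ℝ × ℝ) × ℝ)
        = p1 • ((1, 0), 0) + p2 • ((0, 1), 0) + t • ((0, 0), 1) := by
      simp
    rw [this, map_add, map_add, map_smul, map_smul, map_smul]
    simp [hA, hB, hτ]
  -- The point above `(y, k y)` lies in the epigraph because `y` is interior, so the separating
  -- hyperplane is not vertical.
  have hτpos : 0 < τ := by
    have := hf (y, k y + 1) ⟨hyU, by simp⟩
    rw [hdec, hdec] at this
    linarith
  have hmain : ∀ p ∈ U, y.1 * A + y.2 * B + k y * τ ≤ p.1 * A + p.2 * B + k p * τ := by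
    intro p hp
    refine le_of_forall_pos_le_add fun ε hε => ?_
    have := hf (p, k p + ε / τ) ⟨hp, by simp; positivity⟩
    rw [hdec, hdec] at this
    have h2 : (k p + ε / τ) * τ = k p * τ + ε := by field_simp
    linarith
  refine ⟨k y + (y.1 * A + y.2 * B) / τ, -A / τ, -B / τ, ?_, by field_simp; ring⟩
  intro p hp
  -- `k` may jump on the boundary. The midpoint of `p` and `y` is interior, and convexity along the
  -- segment carries the bound on to `p`.
  have hq : (1 / 2 : ℝ) • y + (1 / 2 : ℝ) • p ∈ U := by
    obtain ⟨hp1, hp2, hp3⟩ := hp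
    refine ⟨?_, ?_, ?_⟩ <;> simp <;> linarith
  have hc := hk.2 (hUT hyU) hp (by norm_num : (0 : ℝ) ≤ 1 / 2) (by norm_num : (0 : ℝ) ≤ 1 / 2)
    (by norm_num)
  have hm := hmain _ hq
  simp only [Prod.fst_add, Prod.snd_add, Prod.smul_fst, Prod.smul_snd, smul_eq_mul] at hm hc
  have hkey : y.1 * A + y.2 * B + k y * τ ≤ p.1 * A + p.2 * B + k p * τ := by
    nlinarith [mul_le_mul_of_nonneg_right hc hτpos.le]
  have : k y + (y.1 * A + y.2 * B) / τ + -A / τ * p.1 + -B / τ * p.2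
      = (y.1 * A + y.2 * B + k y * τ - p.1 * A - p.2 * B) / τ := by
    field_simp
    ring
  rw [this, div_le_iff₀ hτpos]
  linarith

/-- An affine minorant of `g` is dominated by one with the monotonicity of `g`. -/
lemma exists_monotone_affine_minorant {α a b : ℝ}
    (h : ∀ p ∈ triangle, α + a * p.1 + b * p.2 ≤ g p) :
    ∃ α' a' b' : ℝ, 0 ≤ a' ∧ b' ≤ 0 ∧ (∀ p ∈ triangle, α' + a' * p.1 + b' * p.2 ≤ g p) ∧
      ∀ p ∈ triangle, α + a * p.1 + b * p.2 ≤ α' + a' * p.1 + b' * p.2 := by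
  have key : ∀ {α a b : ℝ}, b ≤ 0 → (∀ p ∈ triangle, α + a * p.1 + b * p.2 ≤ g p) →
      ∃ α' a' b' : ℝ, 0 ≤ a' ∧ b' ≤ 0 ∧ (∀ p ∈ triangle, α' + a' * p.1 + b' * p.2 ≤ g p) ∧
      ∀ p ∈ triangle, α + a * p.1 + b * p.2 ≤ α' + a' * p.1 + b' * p.2 := by
    intro α a b hb h
    rcases le_total 0 a with ha | ha
    · exact ⟨α, a, b, ha, hb, h, fun p _ => le_rfl⟩
    · refine ⟨α, 0, b, le_rfl, hb, fun p hp => ?_, fun p hp => ?_⟩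
      -- A negative slope in `x₁` can be replaced by `0`: the new function takes its values on the
      -- edge `x₁ = 0`, where `g` is constant and minimal.
      · have h0 := h (0, p.2) ⟨le_rfl, hp.2.1, by simpa using (by linarith [hp.1, hp.2.2])⟩
        rw [g_zero_left] at h0
        have := le_g hp
        simp only at h0
        linarith
      · have := mul_nonneg_of_nonpos_of_nonpos ha (neg_nonpos.2 hp.1)
        linarith
  rcases le_total b 0 with hb | hb
  · exact key hb h
  -- A positive slope in `x₂` is removed by extending the values on the hypotenuse constantly in
  -- `x₂`; `g` is smallest there along each such line.
  · obtain ⟨α', a', b', h1, h2, h3, h4⟩ := key (α := α + b) (a := a - b) (b := 0) le_rfl (by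
      intro p hp
      have := h (p.1, 1 - p.1) ⟨hp.1, by simp; linarith [hp.2.1, hp.2.2], by simp⟩
      have h2 := g_antitone_right (y₂ := 1 - p.1) hp.1 hp.2.1 (by linarith [hp.2.2]) (by linarith)
      simp only [Prod.mk.eta] at this h2
      linarith)
    refine ⟨α', a', b', h1, h2, h3, fun p hp => le_trans ?_ (h4 p hp)⟩
    have := mul_le_mul_of_nonneg_left hp.2.2 hb
    linarith

/-! ### Cascade values of lists -/

/-- The total weight collected along a list when the top position has visibility `ν` and
visibility decays by the factor `r` from one position to the next. -/
def cascadeSum {ι : Type*} (ν r : ℝ) (a : ι → ℝ) : List ι → ℝ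
  | [] => 0
  | i :: S => ν * a i + r * cascadeSum ν r a S

section Cascade

variable {ι : Type*} {ν r : ℝ}

lemma cascadeSum_mono (hν : 0 ≤ ν) (hr : 0 ≤ r) {a b : ι → ℝ} (h : ∀ i, a i ≤ b i)
    (S : List ι) : cascadeSum ν r a S ≤ cascadeSum ν r b S := by
  induction S with
  | nil => exact le_rfl
  | cons i S ih =>
    exact add_le_add (mul_le_mul_of_nonneg_left (h i) hν) (mul_le_mul_of_nonneg_left ih hr)

lemma cascadeSum_add (a b : ι → ℝ) (S : List ι) :
    cascadeSum ν r (fun i => a i + b i) S = cascadeSum ν r a S + cascadeSum ν r b S := by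
  induction S with
  | nil => simp [cascadeSum]
  | cons i S ih => simp only [cascadeSum, ih]; ring

lemma cascadeSum_nonneg (hν : 0 ≤ ν) (hr : 0 ≤ r) {a : ι → ℝ} (h : ∀ i, 0 ≤ a i)
    (S : List ι) : 0 ≤ cascadeSum ν r a S := by
  induction S with
  | nil => exact le_rfl
  | cons i S ih => exact add_nonneg (mul_nonneg hν (h i)) (mul_nonneg hr ih)

/-- Dropping one element of a list, `i` if it is there, and moving up what is below it, loses at
most one top-position weight. -/
lemma exists_sublist_cascadeSum_le (hν : 0 ≤ ν) (hr : 0 ≤ r) (hr1 : r ≤ 1) {b : ι → ℝ} {θ : ℝ}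
    (hθ : 0 ≤ θ) (hb : ∀ i, b i ≤ θ) (i : ι) {T : List ι} (hT : T.Nodup) :
    ∃ T' : List ι, T'.Sublist T ∧ i ∉ T' ∧ T'.length ≤ T.length - 1 ∧
      cascadeSum ν r b T ≤ ν * θ + r * cascadeSum ν r b T' := by
  classical
  induction T with
  | nil => exact ⟨[], List.Sublist.refl _, by simp, by simp, by simp [cascadeSum]; positivity⟩
  | cons j T ih =>
    rw [List.nodup_cons] at hT
    by_cases hj : j = i
    · subst hj
      refine ⟨T, List.sublist_cons_self _ _, hT.1, by simp, ?_⟩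
      simp only [cascadeSum]
      linarith [mul_le_mul_of_nonneg_left (hb j) hν]
    · rcases T.eq_nil_or_concat' with rfl | ⟨L, x, hL⟩
      · refine ⟨[], List.nil_sublist _, by simp, by simp, ?_⟩
        simp only [cascadeSum]
        linarith [mul_le_mul_of_nonneg_left (hb j) hν]
      · have hlen : 0 < T.length := by simp [hL]
        obtain ⟨T', h1, h2, h3, h4⟩ := ih hT.2
        refine ⟨j :: T', h1.cons_cons j, by simp [h2, Ne.symm hj], by simp; omega, ?_⟩
        simp only [cascadeSum]
        -- The weight `θ` moves from the second position to the top and `b j` moves down; as `b j ≤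
        -- θ`, this exchange does not lose.
        have e1 := mul_le_mul_of_nonneg_left h4 hr
        have e2 : 0 ≤ ν * ((1 - r) * (θ - b j)) :=
          mul_nonneg hν (mul_nonneg (by linarith) (by linarith [hb j]))
        linarith

/-- The parts of the weights above the level `θ` along `S` and the parts below the level `θ`
along `T` can be collected simultaneously by a single list. -/
lemma exists_cascadeSum_merge (hν : 0 ≤ ν) (hr : 0 ≤ r) (hr1 : r ≤ 1) {a : ι → ℝ} {θ : ℝ}
    (hθ : 0 ≤ θ) {S T : List ι} {K : ℕ} (hS : S.Nodup) (hT : T.Nodup) (hSK : S.length ≤ K)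
    (hTK : T.length ≤ K) :
    ∃ R : List ι, R.Nodup ∧ R.length ≤ K ∧ (∀ x ∈ R, x ∈ S ∨ x ∈ T) ∧
      cascadeSum ν r (fun i => max (a i - θ) 0) S + cascadeSum ν r (fun i => min (a i) θ) T
        ≤ cascadeSum ν r a R := by
  induction S generalizing T K with
  | nil =>
    refine ⟨T, hT, hTK, fun x hx => Or.inr hx, ?_⟩
    simp only [cascadeSum, zero_add]
    exact cascadeSum_mono hν hr (fun i => min_le_left _ _) T
  | cons i S ih =>
    rw [List.nodup_cons] at hS
    simp only [List.length_cons] at hSK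
    by_cases hi : a i ≤ θ
    -- An entry with no excess is skipped; moving the rest of `S` up only helps because `r ≤ 1`.
    · obtain ⟨R, h1, h2, h3, h4⟩ := ih hS.2 hT (by omega) hTK
      refine ⟨R, h1, h2, fun x hx => (h3 x hx).imp_left (List.mem_cons_of_mem _), le_trans ?_ h4⟩
      have h0 := cascadeSum_nonneg hν hr (a := fun i => max (a i - θ) 0)
        (fun i => le_max_right _ _) S
      have : max (a i - θ) 0 = 0 := max_eq_right (by linarith)
      simp only [cascadeSum, this, mul_zero, zero_add]
      linarith [mul_le_of_le_one_left h0 hr1]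
    · push Not at hi
      obtain ⟨T', t1, t2, t3, t4⟩ := exists_sublist_cascadeSum_le hν hr hr1
        (b := fun i => min (a i) θ) hθ (fun i => min_le_right _ _) i hT
      obtain ⟨R, h1, h2, h3, h4⟩ := ih (K := K - 1) hS.2 (t1.nodup hT) (by omega) (by omega)
      refine ⟨i :: R, List.nodup_cons.2 ⟨fun hR => ?_, h1⟩, by simp; omega, ?_, ?_⟩
      · exact (h3 i hR).elim hS.1 t2
      · intro x hx
        rcases List.mem_cons.1 hx with rfl | hx
        · exact Or.inl (by simp)
        · exact (h3 x hx).imp (List.mem_cons_of_mem _) (fun h => t1.subset h)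
      · have : max (a i - θ) 0 = a i - θ := max_eq_left (by linarith)
        simp only [cascadeSum, this]
        have := mul_le_mul_of_nonneg_left h4 hr
        linarith

/-- A list that maximizes the cascade sum of `a` also maximizes the cascade sum of the parts of
the weights above any level. -/
lemma cascadeSum_truncate_le (hν : 0 ≤ ν) (hr : 0 ≤ r) (hr1 : r ≤ 1) {a : ι → ℝ} {θ : ℝ}
    (hθ : 0 ≤ θ) {S T : List ι} {K : ℕ} (hS : S.Nodup) (hT : T.Nodup) (hSK : S.length ≤ K)
    (hTK : T.length ≤ K)
    (hmax : ∀ R : List ι, R.Nodup → R.length ≤ K → cascadeSum ν r a R ≤ cascadeSum ν r a T) :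
    cascadeSum ν r (fun i => max (a i - θ) 0) S
      ≤ cascadeSum ν r (fun i => max (a i - θ) 0) T := by
  obtain ⟨R, h1, h2, -, h4⟩ := exists_cascadeSum_merge hν hr hr1 (a := a) hθ hS hT hSK hTK
  have h5 := h4.trans (hmax R h1 h2)
  have h6 : a = fun i => max (a i - θ) 0 + min (a i) θ := by
    funext i
    rcases le_total (a i) θ with h | h
    · rw [max_eq_right (by linarith), min_eq_left h, zero_add]
    · rw [max_eq_left (by linarith), min_eq_right h]; ring
  have h7 : cascadeSum ν r a T = _ := (congrArg (cascadeSum ν r · T) h6).trans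
    (cascadeSum_add _ _ _)
  linarith

end Cascade

/-! ### Sign-up probabilities -/

namespace InternalType

variable {n : ℕ} (v : InternalType n)

/-- The factor by which visibility decays from one position to the next. -/
def decay : ℝ := (1 - v.ν) * (1 - v.q)

lemma decay_nonneg : 0 ≤ v.decay :=
  mul_nonneg (by linarith [v.ν_le_one]) (by linarith [v.q_le_one])

lemma decay_le_one : v.decay ≤ 1 :=
  mul_le_one₀ (by linarith [v.ν_pos]) (by linarith [v.q_le_one]) (by linarith [v.q_nonneg])

lemma signUpProb_nonneg (S : List (Fin n)) (o : Option (Fin n)) : 0 ≤ v.signUpProb S o := by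
  induction S with
  | nil => simp only [signUpProb]; split_ifs <;> norm_num
  | cons i S ih =>
    have h1 := v.ν_pos
    have h2 : 0 ≤ 1 - v.ν := by linarith [v.ν_le_one]
    have h3 := v.q_nonneg
    have h4 : 0 ≤ 1 - v.q := by linarith [v.q_le_one]
    have h5 := v.μ_nonneg i
    have h6 : 0 ≤ 1 - v.μ i := by linarith [v.μ_le_one i]
    simp only [signUpProb]
    split_ifs <;> positivity

lemma sum_signUpProb (S : List (Fin n)) : ∑ o, v.signUpProb S o = 1 := by
  induction S with
  | nil => simp [signUpProb]
  | cons i S ih =>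
    simp only [signUpProb, Finset.sum_add_distrib, ← Finset.mul_sum, ih, Fintype.sum_option]
    simp

lemma sum_signUpProb_mul (S : List (Fin n)) (w : Fin n → ℝ) :
    ∑ i, v.signUpProb S (some i) * w i = cascadeSum v.ν v.decay (fun i => v.μ i * w i) S := by
  induction S with
  | nil => simp [signUpProb, cascadeSum]
  | cons i S ih =>
    have h : ∀ j, v.signUpProb (i :: S) (some j) * w j
        = v.ν * (if j = i then v.μ i * w i else 0)
          + v.decay * (v.signUpProb S (some j) * w j) := by
      intro j
      simp only [signUpProb, decay, Option.some_inj, reduceCtorEq, if_false]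
      by_cases hj : j = i
      · subst hj
        simp only [if_true]
        ring
      · simp only [hj, if_false]
        ring
    simp only [h, Finset.sum_add_distrib, ← Finset.mul_sum, ih, cascadeSum]
    simp

end InternalType

namespace Volunteer

variable {n : ℕ} (v : Volunteer n)

lemma signUpProb_nonneg (S : List (Fin n)) (o : Option (Fin n)) : 0 ≤ v.signUpProb S o := by
  cases v with
  | external j => simp only [signUpProb]; split_ifs <;> norm_num
  | internal v => exact v.signUpProb_nonneg S o

lemma sum_signUpProb (S : List (Fin n)) : ∑ o, v.signUpProb S o = 1 := by
  cases v with
  | external j => simp [signUpProb]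
  | internal v => exact v.sum_signUpProb S

/-- Expectations over the sign-up decision split into the value without any sign-up and the
increments due to the sign-ups. -/
lemma sum_signUpProb_mul (S : List (Fin n)) (F : Option (Fin n) → ℝ) :
    ∑ o, v.signUpProb S o * F o
      = F none + ∑ i, v.signUpProb S (some i) * (F (some i) - F none) := by
  have h := v.sum_signUpProb S
  rw [Fintype.sum_option] at h ⊢
  simp only [mul_sub, Finset.sum_sub_distrib, ← Finset.sum_mul]
  have : v.signUpProb S none = 1 - ∑ i, v.signUpProb S (some i) := by linarith
  rw [this]
  ring

end Volunteer

/-- A bound on the conversion probability ratio compares all positive conversion probabilities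
with a common upper bound. -/
lemma Volunteer.exists_bound_of_cpr_le {n : ℕ} {v : Volunteer n} {σ : ℝ} (h : v.cpr ≤ σ) :
    ∃ M : ℝ, 0 ≤ M ∧ (∀ i, v.μ i ≤ M) ∧ ∀ i, 0 < v.μ i → M ≤ σ * v.μ i := by
  set ι := {i : Fin n // 0 < v.μ i}
  have hup : ∀ i : ι, v.μ i ≤ ⨆ i : ι, v.μ i := fun i => le_ciSup (f := fun i : ι => v.μ i)
    (Set.finite_range _).bddAbove i
  have h0 : 0 ≤ ⨆ i : ι, v.μ i := Real.iSup_nonneg fun i => i.2.le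
  refine ⟨⨆ i : ι, v.μ i, h0, fun i => ?_, fun i hi => ?_⟩
  · by_cases hi : 0 < v.μ i
    · exact hup ⟨i, hi⟩
    · exact (not_lt.1 hi).trans h0
  · have : Nonempty ι := ⟨⟨i, hi⟩⟩
    obtain ⟨j, hj⟩ := exists_eq_ciInf_of_finite (f := fun i : ι => v.μ i)
    have hlow : ⨅ i : ι, v.μ i ≤ v.μ i := ciInf_le (f := fun i : ι => v.μ i)
      (Set.finite_range _).bddBelow ⟨i, hi⟩
    have hpos : 0 < ⨅ i : ι, v.μ i := hj ▸ j.2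
    have h1 : ⨆ i : ι, v.μ i ≤ σ * ⨅ i : ι, v.μ i := (div_le_iff₀ hpos).1 h
    have hσ : 0 ≤ σ := le_trans (div_nonneg h0 hpos.le) h
    exact h1.trans (mul_le_mul_of_nonneg_left hlow hσ)

lemma Volunteer.μ_eq_zero_of_cpr_lt_one {n : ℕ} {v : Volunteer n} (h : v.cpr < 1) (i : Fin n)
    (h0 : 0 ≤ v.μ i) : v.μ i = 0 := by
  by_contra hne
  have hi : 0 < v.μ i := lt_of_le_of_ne h0 (Ne.symm hne)
  obtain ⟨M, -, h2, h3⟩ := Volunteer.exists_bound_of_cpr_le (v := v) (σ := v.cpr) le_rfl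
  have := (h2 i).trans (h3 i hi)
  nlinarith

/-- The comparison of one decision of the adaptive capacity algorithm with one decision of an
arbitrary policy, whose sign-ups are counted with weights `u`. -/
lemma InternalType.sum_signUpProb_le {P : Platform} (v : InternalType P.n) {σ lam : ℝ}
    (hlam : 0 ≤ lam) (hcpr : (Volunteer.internal v).cpr ≤ σ) {w u : Fin P.n → ℝ}
    (hu0 : ∀ i, 0 ≤ u i) (hu1 : ∀ i, u i ≤ 1) {T : P.Ranking}
    (hT : ∀ R : P.Ranking, ∑ i, v.signUpProb R.1 (some i) * w i
      ≤ ∑ i, v.signUpProb T.1 (some i) * w i) (S : P.Ranking) :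
    ∑ i, v.signUpProb S.1 (some i) * (u i * (w i - lam * σ))
      ≤ ∑ i, v.signUpProb T.1 (some i) * max (w i - lam) 0 := by
  obtain ⟨M, hM0, hM1, hM2⟩ := Volunteer.exists_bound_of_cpr_le hcpr
  simp only [Volunteer.μ] at hM1 hM2
  simp only [InternalType.sum_signUpProb_mul] at hT ⊢
  have hν := v.ν_pos.le
  have hr := v.decay_nonneg
  -- The level is `lam * M` with `M` bounding all `μ i`: along `S`, `M ≤ σ * μ i` bounds the credit
  -- by the excess, and along `T`, `μ i ≤ M` bounds the excess by the surplus.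
  refine (cascadeSum_mono hν hr (b := fun i => max (v.μ i * w i - lam * M) 0)
    (fun i => ?_) S.1).trans ((cascadeSum_truncate_le hν hr v.decay_le_one (mul_nonneg hlam hM0)
    S.2.1 T.2.1 S.2.2 T.2.2 fun R h1 h2 => hT ⟨R, h1, h2⟩).trans
    (cascadeSum_mono hν hr (fun i => ?_) T.1))
  · rcases (v.μ_nonneg i).eq_or_lt with h | h
    · simp [← h]
    · have h1 : v.μ i * (w i - lam * σ) ≤ v.μ i * w i - lam * M := by
        linarith [mul_le_mul_of_nonneg_left (hM2 i h) hlam]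
      have h2 : v.μ i * (u i * (w i - lam * σ)) = u i * (v.μ i * (w i - lam * σ)) := by ring
      rw [h2]
      rcases le_total 0 (v.μ i * (w i - lam * σ)) with h3 | h3
      · exact le_max_of_le_left ((mul_le_of_le_one_left h3 (hu1 i)).trans h1)
      · exact le_max_of_le_right (mul_nonpos_of_nonneg_of_nonpos (hu0 i) h3)
  · have h1 : v.μ i * w i - lam * M ≤ v.μ i * (w i - lam) := by
      linarith [mul_le_mul_of_nonneg_left (hM1 i) hlam]
    refine max_le (h1.trans ?_) (mul_nonneg (v.μ_nonneg i) (le_max_right _ _))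
    exact mul_le_mul_of_nonneg_left (le_max_left _ _) (v.μ_nonneg i)

/-! ### Counters along a history -/

namespace Platform

variable {P : Platform}

/-- The number of sign-ups by external volunteers for an opportunity. -/
def extSignUps : P.History → Fin P.n → ℕ
  | [], _ => 0
  | (.external _, o) :: h, i => extSignUps h i + if o = some i then 1 else 0
  | (.internal _, _) :: h, i => extSignUps h i

/-- The number of sign-ups by internal volunteers for an opportunity. -/
def intSignUps : P.History → Fin P.n → ℕ
  | [], _ => 0
  | (.external _, _) :: h, i => intSignUps h i
  | (.internal _, o) :: h, i => intSignUps h i + if o = some i then 1 else 0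

lemma count_eq (h : P.History) (i : Fin P.n) :
    (h.map Prod.snd).count (some i) = extSignUps h i + intSignUps h i := by
  induction h with
  | nil => simp [extSignUps, intSignUps]
  | cons a h ih =>
    obtain ⟨v, o⟩ := a
    cases v <;> simp only [List.map_cons, List.count_cons, ih, extSignUps, intSignUps, beq_iff_eq]
      <;> ring

lemma counters_external (j : Fin P.n) (o : Option (Fin P.n)) (h : P.History) (i : Fin P.n) :
    P.counters ((.external j, o) :: h) i = if o = some i then
      (min (P.cap i - (P.counters h i).2) ((P.counters h i).1 + 1), (P.counters h i).2)
      else P.counters h i := rfl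

lemma counters_internal (v : InternalType P.n) (o : Option (Fin P.n)) (h : P.History)
    (i : Fin P.n) :
    P.counters ((.internal v, o) :: h) i = if o = some i then
      ((P.counters h i).1, min (P.cap i - (P.counters h i).1) ((P.counters h i).2 + 1))
      else P.counters h i := rfl

lemma counters_add (h : P.History) (i : Fin P.n) :
    (P.counters h i).1 + (P.counters h i).2
      = min (P.cap i) (extSignUps h i + intSignUps h i) := by
  induction h with
  | nil => simp [counters, extSignUps, intSignUps]
  | cons a h ih =>
    obtain ⟨v, o⟩ := a
    cases v <;> simp only [counters_external, counters_internal, extSignUps, intSignUps]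
      <;> split_ifs <;> (try simp only) <;> omega

/-- Capacity used is never released, so an opportunity that still has room has not discarded any
sign-up. -/
lemma counters_fst_eq (h : P.History) (i : Fin P.n)
    (hlt : (P.counters h i).1 + (P.counters h i).2 < P.cap i) :
    (P.counters h i).1 = extSignUps h i := by
  induction h with
  | nil => simp [counters, extSignUps]
  | cons a h ih =>
    have hadd := counters_add h i
    obtain ⟨v, o⟩ := a
    cases v <;> simp only [counters_external, counters_internal, extSignUps] at hlt ⊢
      <;> split_ifs at hlt ⊢ <;> (try simp only at hlt ⊢) <;> omega

lemma counters_mono (a : Volunteer P.n × Option (Fin P.n)) (h : P.History) (i : Fin P.n) :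
    (P.counters h i).1 ≤ (P.counters (a :: h) i).1
      ∧ (P.counters h i).2 ≤ (P.counters (a :: h) i).2 := by
  have hadd := counters_add h i
  obtain ⟨v, o⟩ := a
  cases v <;> simp only [counters_external, counters_internal]
    <;> split_ifs <;> (try simp only) <;> omega

lemma counters_add_le (h : P.History) (i : Fin P.n) :
    (P.counters h i).1 + (P.counters h i).2 ≤ P.cap i :=
  counters_add h i ▸ min_le_left _ _

lemma filled_eq (h : P.History) :
    P.filled h = ∑ i, (((P.counters h i).1 + (P.counters h i).2 : ℕ) : ℝ) := by
  simp only [filled, count_eq, counters_add]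

lemma fillRate_nonneg (h : P.History) (i : Fin P.n) : 0 ≤ P.fillRate h i := by
  have : ((P.counters h i).1 : ℝ) ≤ P.cap i := by
    exact_mod_cast (Nat.le_add_right _ _).trans (counters_add_le h i)
  unfold fillRate
  split_ifs
  · norm_num
  · exact div_nonneg (Nat.cast_nonneg _) (by linarith)

lemma fillRate_of_full (h : P.History) (i : Fin P.n)
    (hf : (P.counters h i).1 + (P.counters h i).2 = P.cap i) : P.fillRate h i = 1 := by
  unfold fillRate
  split_ifs with h1
  · rfl
  · have h2 : (P.cap i : ℝ) - (P.counters h i).1 = (P.counters h i).2 := by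
      rw [← hf]; push_cast; ring
    rw [h2, div_self]
    have : (P.counters h i).2 ≠ 0 := by omega
    exact_mod_cast this

lemma fillRate_mono (a : Volunteer P.n × Option (Fin P.n)) (h : P.History) (i : Fin P.n) :
    P.fillRate h i ≤ P.fillRate (a :: h) i := by
  obtain ⟨h1, h2⟩ := counters_mono a h i
  have h3 := counters_add_le h i
  have h4 := counters_add_le (a :: h) i
  by_cases hf : (P.counters (a :: h) i).1 = P.cap i
  · rw [fillRate_of_full (a :: h) i (by omega)]
    unfold fillRate
    split_ifs with h5
    · exact le_rfl
    · have h6 : (P.counters h i).1 < P.cap i := by omega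
      have h7 : ((P.counters h i).1 : ℝ) < P.cap i := by exact_mod_cast h6
      have h8 : ((P.counters h i).1 : ℝ) + (P.counters h i).2 ≤ P.cap i := by exact_mod_cast h3
      rw [div_le_one (by linarith)]
      linarith
  · have h5 : (P.counters (a :: h) i).1 < P.cap i := by omega
    have h6 : (P.counters h i).1 ≠ P.cap i := by omega
    have h7 : ((P.counters (a :: h) i).1 : ℝ) < P.cap i := by exact_mod_cast h5
    have h8 : ((P.counters h i).1 : ℝ) ≤ (P.counters (a :: h) i).1 := by exact_mod_cast h1
    have h9 : ((P.counters h i).2 : ℝ) ≤ (P.counters (a :: h) i).2 := by exact_mod_cast h2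
    unfold fillRate
    rw [if_neg hf, if_neg h6]
    exact div_le_div₀ (Nat.cast_nonneg _) h9 (by linarith) (by linarith)

lemma fillRate_le_one (h : P.History) (i : Fin P.n) : P.fillRate h i ≤ 1 := by
  have h3 := counters_add_le h i
  unfold fillRate
  split_ifs with h5
  · exact le_rfl
  · have h6 : (P.counters h i).1 < P.cap i := by omega
    have h7 : ((P.counters h i).1 : ℝ) < P.cap i := by exact_mod_cast h6
    have h8 : ((P.counters h i).1 : ℝ) + (P.counters h i).2 ≤ P.cap i := by exact_mod_cast h3
    rw [div_le_one (by linarith)]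
    linarith

end Platform

namespace Platform

variable {P : Platform}

/-! ### The surplus of the trade-off function over a level -/

/-- The surplus of the discounted fill rates over the level `lam`, accumulated over the internal
sign-ups for an opportunity. -/
def surplus (lam : ℝ) : P.History → Fin P.n → ℝ
  | [], _ => 0
  | (.external _, _) :: h, i => surplus lam h i
  | (.internal _, o) :: h, i =>
      surplus lam h i + if o = some i then max (psi (P.fillRate h i) - lam) 0 else 0

/-- The number of internal sign-ups that contribute to the surplus. -/
def surplusCount (lam : ℝ) : P.History → Fin P.n → ℕ
  | [], _ => 0
  | (.external _, _) :: h, i => surplusCount lam h i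
  | (.internal _, o) :: h, i =>
      surplusCount lam h i + if o = some i ∧ lam < psi (P.fillRate h i) then 1 else 0

lemma div_le_fillRate (h : P.History) (i : Fin P.n) :
    ((P.counters h i).2 : ℝ) / P.cap i ≤ P.fillRate h i := by
  have h3 := counters_add_le h i
  have hc : (0 : ℝ) < P.cap i := by exact_mod_cast P.cap_pos i
  have h8 : ((P.counters h i).1 : ℝ) + (P.counters h i).2 ≤ P.cap i := by exact_mod_cast h3
  have h9 : (0 : ℝ) ≤ (P.counters h i).1 := Nat.cast_nonneg _
  unfold fillRate
  split_ifs with h5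
  · rw [div_le_one hc]
    linarith
  · have h6 : (P.counters h i).1 < P.cap i := by omega
    have h7 : ((P.counters h i).1 : ℝ) < P.cap i := by exact_mod_cast h6
    exact div_le_div₀ (Nat.cast_nonneg _) le_rfl (by linarith) (by linarith)

/-- At a full opportunity `ψ(1) = 0 ≤ lam`, so every sign-up that is counted here also raises the
internal counter. -/
lemma surplusCount_le (lam : ℝ) (hlam : 0 ≤ lam) (h : P.History) (i : Fin P.n) :
    surplusCount lam h i ≤ (P.counters h i).2 := by
  induction h with
  | nil => simp [surplusCount]
  | cons a h ih =>
    have hmono := (counters_mono a h i).2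
    obtain ⟨v, o⟩ := a
    cases v with
    | external j => exact ih.trans hmono
    | internal v =>
      simp only [surplusCount]
      split_ifs with hc
      · obtain ⟨rfl, hc⟩ := hc
        have hlt : (P.counters h i).1 + (P.counters h i).2 < P.cap i := by
          refine lt_of_le_of_ne (counters_add_le h i) fun hf => ?_
          rw [fillRate_of_full h i hf, psi_one] at hc
          linarith
        rw [counters_internal, if_pos rfl]
        simp only
        omega
      · exact ih.trans hmono

/-- The right side is the sum of `exp (FR - 1)` over the counted sign-ups. When `m` of them have
occurred, the fill rate is at least `m / cap`, so the sum dominates a left Riemann sum of `exp (x /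
cap - 1)`. The factor `γ` absorbs the gap between this sum and the integral. -/
lemma surplus_bound {lam γ : ℝ} (hlam : 0 ≤ lam) (i : Fin P.n)
    (hγ : γ ≤ Real.exp (-1 / (P.cap i : ℝ))) (h : P.History) :
    γ * (P.cap i * (Real.exp ((surplusCount lam h i : ℝ) / P.cap i - 1) - 1 / Real.exp 1))
      ≤ surplusCount lam h i - (surplus lam h i + lam * surplusCount lam h i) := by
  have hc : (0 : ℝ) < P.cap i := by exact_mod_cast P.cap_pos i
  induction h with
  | nil => simp [surplus, surplusCount, Real.exp_neg]
  | cons a h ih =>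
    obtain ⟨v, o⟩ := a
    cases v with
    | external j => exact ih
    | internal v =>
      simp only [surplusCount, surplus]
      by_cases ho : o = some i
      · by_cases hp : lam < psi (P.fillRate h i)
        · have hmax : max (psi (P.fillRate h i) - lam) 0 = psi (P.fillRate h i) - lam :=
            max_eq_left (by linarith)
          simp only [ho, hp, hmax, true_and, if_true]
          set m := surplusCount lam h i with hm
          have h1 : (m : ℝ) / P.cap i ≤ P.fillRate h i := by
            refine le_trans ?_ (div_le_fillRate h i)
            have : (m : ℝ) ≤ (P.counters h i).2 := by
              exact_mod_cast surplusCount_le lam hlam h i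
            gcongr
          have h2 : Real.exp ((m : ℝ) / P.cap i - 1) ≤ 1 - psi (P.fillRate h i) := by
            unfold psi
            have := Real.exp_le_exp.2 (sub_le_sub_right h1 1)
            linarith
          have h3 : Real.exp (((m + 1 : ℕ) : ℝ) / P.cap i - 1)
              = Real.exp ((m : ℝ) / P.cap i - 1) * Real.exp (1 / (P.cap i : ℝ)) := by
            rw [← Real.exp_add]
            congr 1
            push_cast
            ring
          have h4 : γ * (P.cap i * (Real.exp (1 / (P.cap i : ℝ)) - 1)) ≤ 1 := by
            have e1 := Real.add_one_le_exp (-1 / (P.cap i : ℝ))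
            have e2 : Real.exp (-1 / (P.cap i : ℝ)) * Real.exp (1 / (P.cap i : ℝ)) = 1 := by
              rw [← Real.exp_add, neg_div, neg_add_cancel, Real.exp_zero]
            have e3 : 0 ≤ Real.exp (1 / (P.cap i : ℝ)) - 1 := by
              have := Real.one_le_exp (x := 1 / (P.cap i : ℝ)) (by positivity)
              linarith
            calc γ * (P.cap i * (Real.exp (1 / (P.cap i : ℝ)) - 1))
                ≤ Real.exp (-1 / (P.cap i : ℝ))
                  * (P.cap i * (Real.exp (1 / (P.cap i : ℝ)) - 1)) := by gcongr
              _ = P.cap i * (1 - Real.exp (-1 / (P.cap i : ℝ))) := by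
                linear_combination (P.cap i : ℝ) * e2
              _ ≤ P.cap i * (1 / (P.cap i : ℝ)) := by
                gcongr
                rw [neg_div] at e1 ⊢
                linarith
              _ = 1 := by field_simp
          have h5 := mul_le_mul_of_nonneg_right h4 (Real.exp_pos ((m : ℝ) / P.cap i - 1)).le
          rw [h3]
          push_cast
          linarith
        · have hmax : max (psi (P.fillRate h i) - lam) 0 = 0 :=
            max_eq_right (by linarith)
          simpa only [ho, hp, hmax, and_false, if_false, if_true, add_zero] using ih
      · simpa only [ho, false_and, if_false, add_zero] using ih

/-- The accounting for one opportunity at the end of the horizon. -/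
lemma affine_le_of_minorant {α a b γ : ℝ} (ha : 0 ≤ a) (hb : b ≤ 0)
    (hg : ∀ p ∈ triangle, α + a * p.1 + b * p.2 ≤ g p) (hγ0 : 0 ≤ γ) (i : Fin P.n)
    (hγ : γ ≤ Real.exp (-1 / (P.cap i : ℝ))) (h : P.History) :
    γ * (P.cap i * α + a * (((P.counters h i).1 + (P.counters h i).2 : ℕ) : ℝ))
      ≤ (((P.counters h i).1 + (P.counters h i).2 : ℕ) : ℝ) - surplus (γ * (a - b)) h i
        + γ * ((P.cap i - (P.counters h i).1) * psi (P.fillRate h i)) := by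
  have hlam : 0 ≤ γ * (a - b) := mul_nonneg hγ0 (by linarith)
  have hc : (0 : ℝ) < P.cap i := by exact_mod_cast P.cap_pos i
  have hinv := surplus_bound hlam i hγ h
  have hM : (surplusCount (γ * (a - b)) h i : ℝ) ≤ (P.counters h i).2 := by
    exact_mod_cast surplusCount_le _ hlam h i
  have hEN : ((P.counters h i).1 : ℝ) + (P.counters h i).2 ≤ P.cap i := by
    exact_mod_cast counters_add_le h i
  have hFR : P.fillRate h i = if ((P.counters h i).1 : ℝ) = P.cap i then 1
      else ((P.counters h i).2 : ℝ) / ((P.cap i : ℝ) - (P.counters h i).1) := by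
    unfold fillRate
    simp only [Nat.cast_inj]
  have hM0 : (0 : ℝ) ≤ surplusCount (γ * (a - b)) h i := Nat.cast_nonneg _
  have hE0 : (0 : ℝ) ≤ (P.counters h i).1 := Nat.cast_nonneg _
  have hγ1 : γ ≤ 1 := hγ.trans (Real.exp_le_one_iff.2 (by
    rw [neg_div]; exact neg_nonpos.2 (by positivity)))
  push_cast
  generalize (surplusCount (γ * (a - b)) h i : ℝ) = M at *
  generalize ((P.counters h i).1 : ℝ) = E at *
  generalize ((P.counters h i).2 : ℝ) = N at *
  generalize surplus (γ * (a - b)) h i = W at *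
  generalize (P.cap i : ℝ) = c at *
  -- `N - M` counts the internal sign-ups without surplus; from here on they are booked as external.
  have hpersp : (c - E) * Real.exp (P.fillRate h i - 1)
      ≤ (c - E - (N - M)) * Real.exp (M / (c - E - (N - M)) - 1) + (N - M) := by
    rw [hFR]
    split_ifs with hEc
    · have h1 : N = 0 := by linarith
      have h2 : M = 0 := by linarith
      simp [hEc, h1, h2]
    · have := perspective_exp_le (s := c - E - (N - M)) (w := N - M) hM0 (by linarith)
        (by linarith)
      simpa using this
  -- Relative to this point, the slopes give `a (E + N) - (a - b) M` after scaling by `c`; the level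
  -- `γ (a - b)` is chosen so that the last term cancels against `surplus_bound`.
  have hgp := hg ((E + (N - M)) / c, M / c) ⟨div_nonneg (by linarith) hc.le,
    div_nonneg hM0 hc.le, by simp only; rw [← add_div, div_le_one hc]; linarith⟩
  rw [g_eq] at hgp
  simp only at hgp
  have h1 : 1 - (E + (N - M)) / c = (c - E - (N - M)) / c := by
    field_simp
    ring
  rw [h1, div_div_div_cancel_right₀ hc.ne'] at hgp
  have h2 := mul_le_mul_of_nonneg_left hgp hc.le
  have h3 : c * (α + a * ((E + (N - M)) / c) + b * (M / c))
      = c * α + a * (E + (N - M)) + b * M := by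
    field_simp
  have h4 : c * (1 - 1 / Real.exp 1 + Real.exp (M / c - 1)
      - (c - E - (N - M)) / c * Real.exp (M / (c - E - (N - M)) - 1))
      = c + c * (Real.exp (M / c - 1) - 1 / Real.exp 1)
        - (c - E - (N - M)) * Real.exp (M / (c - E - (N - M)) - 1) := by
    field_simp
    ring
  rw [h3, h4] at h2
  have h5 := mul_le_mul_of_nonneg_left h2 hγ0
  have h6 := mul_le_mul_of_nonneg_left hpersp hγ0
  have h7 : 0 ≤ (1 - γ) * (E + (N - M)) := mul_nonneg (by linarith) (by linarith)
  unfold psi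
  linarith

end Platform

namespace Platform

variable {P : Platform}

/-! ### Two independent runs on the same arrivals -/

/-- The number of external arrivals that target an opportunity. -/
def extTargets : List (Volunteer P.n) → Fin P.n → ℕ
  | [], _ => 0
  | .external j :: L, i => extTargets L i + if j = i then 1 else 0
  | .internal _ :: L, i => extTargets L i

/-- The expectation of `G` at the end of the horizon over independent runs of two policies on the
same arrivals. -/
def jointExp (π ρ : P.Policy) (G : P.History → P.History → ℝ) :
    List (Volunteer P.n) → P.History → P.History → ℝ
  | [], a, b => G a b
  | v :: L, a, b => ∑ o, v.signUpProb (π a v).1 o * ∑ o', v.signUpProb (ρ b v).1 o' *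
      jointExp π ρ G L ((v, o) :: a) ((v, o') :: b)

lemma jointExp_affine (π ρ : P.Policy) (A B D : ℝ) (L : List (Volunteer P.n))
    (a b : P.History) :
    jointExp π ρ (fun a b => A * P.filled a + B * P.filled b + D) L a b
      = A * P.expValue π a L + B * P.expValue ρ b L + D := by
  induction L generalizing a b with
  | nil => rfl
  | cons v L ih =>
    have h1 := v.sum_signUpProb (π a v).1
    have h2 := v.sum_signUpProb (ρ b v).1
    have hsum : ∀ (p y : Option (Fin P.n) → ℝ) (A E : ℝ), ∑ o, p o = 1 →
        ∑ o, p o * (A * y o + E) = A * ∑ o, p o * y o + E := by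
      intro p y A E hp
      simp only [mul_add, Finset.sum_add_distrib, ← Finset.sum_mul, hp, one_mul, Finset.mul_sum,
        mul_left_comm]
    have hin : ∀ o, ∑ o', v.signUpProb (ρ b v).1 o' * (A * P.expValue π ((v, o) :: a) L
        + B * P.expValue ρ ((v, o') :: b) L + D)
        = A * P.expValue π ((v, o) :: a) L + (B * P.expValue ρ b (v :: L) + D) := by
      intro o
      have := hsum _ (fun o' => P.expValue ρ ((v, o') :: b) L) B
        (A * P.expValue π ((v, o) :: a) L + D) h2
      simp only [expValue]
      rw [add_left_comm, ← this]
      exact Finset.sum_congr rfl fun o' _ => by ring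
    simp only [jointExp, ih, hin]
    rw [hsum _ (fun o => P.expValue π ((v, o) :: a) L) A _ h1, add_assoc]
    rfl

/-- External sign-ups are deterministic, so on runs of positive probability their final number is
fixed by the arrivals, and the integrands need comparing only there. -/
lemma jointExp_mono (π ρ : P.Policy) {G G' : P.History → P.History → ℝ}
    (L : List (Volunteer P.n)) (a b : P.History)
    (hG : ∀ a' b', (∀ i, extSignUps a' i = extSignUps a i + extTargets L i) →
      (∀ i, extSignUps b' i = extSignUps b i + extTargets L i) → G a' b' ≤ G' a' b') :
    jointExp π ρ G L a b ≤ jointExp π ρ G' L a b := by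
  induction L generalizing a b with
  | nil => exact hG a b (fun i => rfl) fun i => rfl
  | cons v L ih =>
    simp only [jointExp]
    have key : ∀ (c : P.History) (S : List (Fin P.n)) (o : Option (Fin P.n)),
        v.signUpProb S o ≠ 0 →
        ∀ i, extSignUps ((v, o) :: c) i + extTargets L i = extSignUps c i
          + extTargets (v :: L) i := by
      intro c S o ho i
      cases v with
      | external j =>
        have : o = some j := by
          by_contra hne
          exact ho (if_neg hne)
        subst this
        simp only [extSignUps, extTargets, Option.some_inj]
        ring
      | internal v => rfl
    refine Finset.sum_le_sum fun o _ => ?_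
    rcases (v.signUpProb_nonneg (π a v).1 o).eq_or_lt with ho | ho
    · simp [← ho]
    refine mul_le_mul_of_nonneg_left (Finset.sum_le_sum fun o' _ => ?_) ho.le
    rcases (v.signUpProb_nonneg (ρ b v).1 o').eq_or_lt with ho' | ho'
    · simp [← ho']
    refine mul_le_mul_of_nonneg_left (ih _ _ fun a' b' ha' hb' => hG a' b' ?_ ?_) ho'.le
    · exact fun i => (ha' i).trans (key a _ o ho.ne' i)
    · exact fun i => (hb' i).trans (key b _ o' ho'.ne' i)

/-- The submartingale inequality. -/
lemma le_jointExp (π ρ : P.Policy) {Φ : P.History → P.History → ℝ} (L : List (Volunteer P.n))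
    (hΦ : ∀ v ∈ L, ∀ a b, Φ a b ≤ ∑ o, v.signUpProb (π a v).1 o *
      ∑ o', v.signUpProb (ρ b v).1 o' * Φ ((v, o) :: a) ((v, o') :: b))
    (a b : P.History) : Φ a b ≤ jointExp π ρ Φ L a b := by
  induction L generalizing a b with
  | nil => exact le_rfl
  | cons v L ih =>
    refine (hΦ v (by simp) a b).trans ?_
    simp only [jointExp]
    refine Finset.sum_le_sum fun o _ => mul_le_mul_of_nonneg_left
      (Finset.sum_le_sum fun o' _ => mul_le_mul_of_nonneg_left ?_ (v.signUpProb_nonneg _ _))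
      (v.signUpProb_nonneg _ _)
    exact ih (fun v hv => hΦ v (List.mem_cons_of_mem _ hv)) _ _

/-- The value that weights `w` give to the internal sign-ups, of which at most `r i` count. -/
def credit (r : Fin P.n → ℕ) (w : Fin P.n → ℝ) (b : P.History) : ℝ :=
  ∑ i, ((min (r i) (intSignUps b i) : ℕ) : ℝ) * w i

/-- The potential that compares the surplus of the first run with the credit of the second. -/
def potential (lam σ : ℝ) (r : Fin P.n → ℕ) (a b : P.History) : ℝ :=
  ∑ i, surplus lam a i - credit r (fun i => psi (P.fillRate a i) - lam * σ) b

/-! ### Drift and terminal value of the potential -/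

lemma surplus_sub (lam : ℝ) (v : InternalType P.n) (a : P.History) (j : Fin P.n) :
    ∑ i, surplus lam ((.internal v, some j) :: a) i - ∑ i, surplus lam ((.internal v, none) :: a) i
      = max (psi (P.fillRate a j) - lam) 0 := by
  simp [surplus, Finset.sum_add_distrib]

lemma credit_sub (r : Fin P.n → ℕ) (w : Fin P.n → ℝ) (v : InternalType P.n) (b : P.History)
    (j : Fin P.n) :
    credit r w ((.internal v, some j) :: b) - credit r w ((.internal v, none) :: b)
      = (((min (r j) (intSignUps b j + 1) : ℕ) : ℝ) - ((min (r j) (intSignUps b j) : ℕ) : ℝ))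
        * w j := by
  unfold credit
  rw [← Finset.sum_sub_distrib, Finset.sum_eq_single j]
  · simp only [intSignUps, if_true, reduceCtorEq, if_false, add_zero]
    ring
  · intro i _ hi
    have : ¬ (j = i) := fun h => hi h.symm
    simp [intSignUps, this]
  · simp

/-- Only the effect of the new sign-ups matters once the credit weights are frozen. The two runs are
independent, so the expectation splits, and the comparison reduces to a single decision,
`InternalType.sum_signUpProb_le`, where `u` is the increment of the capped count. -/
lemma potential_le_step {alg : OnlineAlgorithm} (halg : IsACR alg) (ρ : P.Policy) {lam σ : ℝ}
    (hlam : 0 ≤ lam) (r : Fin P.n → ℕ) {v : Volunteer P.n} (hv : v.cpr ≤ σ) (a b : P.History) :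
    potential lam σ r a b ≤ ∑ o, v.signUpProb (alg P a v).1 o *
      ∑ o', v.signUpProb (ρ b v).1 o' * potential lam σ r ((v, o) :: a) ((v, o') :: b) := by
  set w : Fin P.n → ℝ := fun i => psi (P.fillRate a i) - lam * σ with hw
  -- Fill rates only rise and `psi` decreases, so updating the weights can only lower the credit.
  have hfreeze : ∀ o o', ∑ i, surplus lam ((v, o) :: a) i - credit r w ((v, o') :: b)
      ≤ potential lam σ r ((v, o) :: a) ((v, o') :: b) := by
    intro o o'
    refine sub_le_sub_left (Finset.sum_le_sum fun i _ => ?_) _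
    refine mul_le_mul_of_nonneg_left ?_ (Nat.cast_nonneg _)
    exact sub_le_sub_right (psi_antitone (fillRate_mono _ a i)) _
  have hsum : ∑ o, v.signUpProb (alg P a v).1 o * ∑ i, surplus lam ((v, o) :: a) i
        - ∑ o', v.signUpProb (ρ b v).1 o' * credit r w ((v, o') :: b)
      ≤ ∑ o, v.signUpProb (alg P a v).1 o *
        ∑ o', v.signUpProb (ρ b v).1 o' * potential lam σ r ((v, o) :: a) ((v, o') :: b) := by
    have h1 := v.sum_signUpProb (alg P a v).1
    have h2 := v.sum_signUpProb (ρ b v).1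
    calc _ = ∑ o, v.signUpProb (alg P a v).1 o * ∑ o', v.signUpProb (ρ b v).1 o' *
          (∑ i, surplus lam ((v, o) :: a) i - credit r w ((v, o') :: b)) := by
          simp only [mul_sub, Finset.sum_sub_distrib, ← Finset.sum_mul, h1, h2, one_mul]
      _ ≤ _ := Finset.sum_le_sum fun o _ => mul_le_mul_of_nonneg_left
          (Finset.sum_le_sum fun o' _ => mul_le_mul_of_nonneg_left (hfreeze o o')
            (v.signUpProb_nonneg _ _)) (v.signUpProb_nonneg _ _)
  refine le_trans ?_ hsum
  rw [Volunteer.sum_signUpProb_mul, Volunteer.sum_signUpProb_mul]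
  cases v with
  | external j =>
    have h1 : ∀ o, ∑ i, surplus lam ((.external j, o) :: a) i = ∑ i, surplus lam a i :=
      fun o => rfl
    have h2 : ∀ o, credit r w ((.external j, o) :: b) = credit r w b := fun o => rfl
    simp only [h1, h2, sub_self, mul_zero, Finset.sum_const_zero, add_zero]
    exact le_rfl
  | internal v =>
    simp only [surplus_sub, credit_sub]
    have h1 : ∑ i, surplus lam ((.internal v, none) :: a) i = ∑ i, surplus lam a i := by
      simp [surplus]
    have h2 : credit r w ((.internal v, none) :: b) = credit r w b := by
      simp [credit, intSignUps]
    rw [h1, h2]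
    have := v.sum_signUpProb_le hlam hv (w := fun i => psi (P.fillRate a i))
      (u := fun i => ((min (r i) (intSignUps b i + 1) : ℕ) : ℝ)
        - ((min (r i) (intSignUps b i) : ℕ) : ℝ))
      (fun i => sub_nonneg.2 (by exact_mod_cast min_le_min_left _ (Nat.le_succ _)))
      (fun i => by
        rw [sub_le_iff_le_add]
        have : min (r i) (intSignUps b i + 1) ≤ 1 + min (r i) (intSignUps b i) := by omega
        exact_mod_cast this)
      (halg P a v) (ρ b (.internal v))
    unfold potential
    simp only [Volunteer.signUpProb]
    linarith

/-- Filled capacity depends only on the number of sign-ups, so all external ones may be counted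
first, whatever the order of arrival. -/
lemma filled_eq_ext_add (b : P.History) (x : Fin P.n → ℕ) (hx : ∀ i, extSignUps b i = x i) :
    P.filled b = ∑ i, ((min (P.cap i) (x i) : ℕ) : ℝ)
      + ∑ i, ((min (P.cap i - x i) (intSignUps b i) : ℕ) : ℝ) := by
  rw [filled, ← Finset.sum_add_distrib]
  refine Finset.sum_congr rfl fun i _ => ?_
  rw [count_eq, hx, ← Nat.cast_add]
  congr 1
  omega

lemma potential_le_terminal {α a b γ σ : ℝ} (ha : 0 ≤ a) (hb : b ≤ 0)
    (hg : ∀ p ∈ triangle, α + a * p.1 + b * p.2 ≤ g p) (hγ0 : 0 ≤ γ)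
    (hγ : ∀ i, γ ≤ Real.exp (-1 / (P.cap i : ℝ))) (x : Fin P.n → ℕ) (h k : P.History)
    (hx : ∀ i, extSignUps h i = x i) (kx : ∀ i, extSignUps k i = x i) :
    potential (γ * (a - b)) σ (fun i => P.cap i - x i) h k
      ≤ (1 - γ * a) * P.filled h
        + (γ * (a - b) * σ - γ * (1 - 1 / Real.exp 1)) * P.filled k
        + (γ * (1 - 1 / Real.exp 1) * (∑ i, (P.cap i : ℝ)) - γ * α * ∑ i, (P.cap i : ℝ)
          - γ * (a - b) * σ * ∑ i, ((min (P.cap i) (x i) : ℕ) : ℝ)) := by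
  rw [filled_eq_ext_add k x kx, filled_eq h]
  unfold potential credit
  simp only [Finset.mul_sum, ← Finset.sum_add_distrib, ← Finset.sum_sub_distrib]
  refine Finset.sum_le_sum fun i _ => ?_
  have h1 := affine_le_of_minorant ha hb hg hγ0 i (hγ i) h
  have hγ1 : γ ≤ 1 := (hγ i).trans (Real.exp_le_one_iff.2 (by
    rw [neg_div]; exact neg_nonpos.2 (by positivity)))
  have hp0 := psi_nonneg (fillRate_le_one h i)
  have hp1 := psi_le (fillRate_nonneg h i)
  have hU : ((min (P.cap i - x i) (intSignUps k i) : ℕ) : ℝ)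
      + ((min (P.cap i) (x i) : ℕ) : ℝ) ≤ P.cap i := by
    have : min (P.cap i - x i) (intSignUps k i) + min (P.cap i) (x i) ≤ P.cap i := by omega
    exact_mod_cast this
  have hU0 : (0 : ℝ) ≤ ((min (P.cap i - x i) (intSignUps k i) : ℕ) : ℝ) := Nat.cast_nonneg _
  -- If the opportunity is full, both sides vanish; otherwise all external arrivals have been
  -- counted.
  have hr : (P.cap i - (P.counters h i).1) * psi (P.fillRate h i)
      ≤ (P.cap i - ((min (P.cap i) (x i) : ℕ) : ℝ)) * psi (P.fillRate h i) := by
    rcases (counters_add_le h i).eq_or_lt with hf | hf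
    · rw [fillRate_of_full h i hf, psi_one]
      simp
    · have e1 := counters_fst_eq h i hf
      have e2 : min (P.cap i) (x i) ≤ (P.counters h i).1 := by
        rw [e1, hx]
        exact min_le_right _ _
      have e3 : ((min (P.cap i) (x i) : ℕ) : ℝ) ≤ (P.counters h i).1 := by exact_mod_cast e2
      exact mul_le_mul_of_nonneg_right (by linarith) hp0
  have h2 := mul_le_mul_of_nonneg_left hr hγ0
  generalize ((min (P.cap i - x i) (intSignUps k i) : ℕ) : ℝ) = U at *
  generalize ((min (P.cap i) (x i) : ℕ) : ℝ) = X at *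
  generalize psi (P.fillRate h i) = p at *
  -- Of the room `cap - X` left by external traffic, the other policy fills `U`, which its credit
  -- covers at price `p`; the rest is priced at the maximum `ψ(0)`.
  have h3 : γ * ((P.cap i - X) * p) ≤ U * p + γ * ((P.cap i - X - U) * (1 - 1 / Real.exp 1)) := by
    have e1 : γ * ((P.cap i - X - U) * p)
        ≤ γ * ((P.cap i - X - U) * (1 - 1 / Real.exp 1)) :=
      mul_le_mul_of_nonneg_left (mul_le_mul_of_nonneg_left hp1 (by linarith)) hγ0
    have e2 : γ * (U * p) ≤ U * p := mul_le_of_le_one_left (mul_nonneg hU0 hp0) hγ1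
    linarith
  linarith

/-- The key inequality between the value of the adaptive capacity algorithm and the value of any
policy. -/
lemma key_inequality {alg : OnlineAlgorithm} (halg : IsACR alg) (ρ : P.Policy)
    {α a b γ σ : ℝ} (ha : 0 ≤ a) (hb : b ≤ 0)
    (hg : ∀ p ∈ triangle, α + a * p.1 + b * p.2 ≤ g p) (hγ0 : 0 ≤ γ)
    (hγ : ∀ i, γ ≤ Real.exp (-1 / (P.cap i : ℝ))) (L : List (Volunteer P.n))
    (hL : ∀ v ∈ L, v.cpr ≤ σ) :
    0 ≤ (1 - γ * a) * P.expValue (alg P) [] L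
        + (γ * (a - b) * σ - γ * (1 - 1 / Real.exp 1)) * P.expValue ρ [] L
        + (γ * (1 - 1 / Real.exp 1) * (∑ i, (P.cap i : ℝ)) - γ * α * ∑ i, (P.cap i : ℝ)
          - γ * (a - b) * σ * ∑ i, ((min (P.cap i) (extTargets L i) : ℕ) : ℝ)) := by
  have hlam : 0 ≤ γ * (a - b) := mul_nonneg hγ0 (by linarith)
  have h0 : potential (γ * (a - b)) σ (fun i => P.cap i - extTargets L i) [] [] = 0 := by
    simp [potential, credit, surplus, intSignUps]
  rw [← jointExp_affine, ← h0]
  refine (le_jointExp (alg P) ρ L (fun v hv a b => potential_le_step halg ρ hlam _ (hL v hv) a b)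
    [] []).trans (jointExp_mono _ _ L [] [] fun h k hx kx => ?_)
  simp only [extSignUps, zero_add] at hx kx
  exact potential_le_terminal ha hb hg hγ0 hγ _ h k hx kx

/-! ### A priori bounds on expected values -/

lemma filled_le (h : P.History) : P.filled h ≤ ∑ i, (P.cap i : ℝ) :=
  Finset.sum_le_sum fun i _ => by exact_mod_cast min_le_left _ _

lemma expValue_le (π : P.Policy) (L : List (Volunteer P.n)) :
    P.expValue π [] L ≤ ∑ i, (P.cap i : ℝ) := by
  have h1 := jointExp_affine π π 1 0 0 L [] []
  have h2 := jointExp_affine π π 0 0 (∑ i, (P.cap i : ℝ)) L [] []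
  have h3 := jointExp_mono π π (G := fun a b => 1 * P.filled a + 0 * P.filled b + 0)
    (G' := fun a b => 0 * P.filled a + 0 * P.filled b + ∑ i, (P.cap i : ℝ)) L [] []
    fun a b _ _ => by simpa using filled_le a
  linarith

lemma le_expValue (π : P.Policy) (L : List (Volunteer P.n)) :
    ∑ i, ((min (P.cap i) (extTargets L i) : ℕ) : ℝ) ≤ P.expValue π [] L := by
  set X := ∑ i, ((min (P.cap i) (extTargets L i) : ℕ) : ℝ) with hX
  have h1 := jointExp_affine π π 1 0 0 L [] []
  have h2 := jointExp_affine π π 0 0 X L [] []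
  have h3 := jointExp_mono π π (G' := fun a b => 1 * P.filled a + 0 * P.filled b + 0)
    (G := fun a b => 0 * P.filled a + 0 * P.filled b + X) L [] []
    fun a b ha _ => by
      simp only [extSignUps, zero_add] at ha
      rw [filled_eq_ext_add a _ ha]
      simp only [zero_mul, zero_add, one_mul, add_zero, ← hX]
      exact le_add_of_nonneg_right (Finset.sum_nonneg fun i _ => Nat.cast_nonneg _)
  linarith

/-- If no volunteer ever signs up, then the value is that of the current history. -/
lemma expValue_eq_filled (π : P.Policy) (L : List (Volunteer P.n)) (h : P.History)
    (hL : ∀ v ∈ L, ∀ i, v.μ i = 0) : P.expValue π h L = P.filled h := by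
  induction L generalizing h with
  | nil => rfl
  | cons v L ih =>
    have hv := hL v (by simp)
    cases v with
    | external j => simpa [Volunteer.μ] using hv j
    | internal v =>
      simp only [Volunteer.μ] at hv
      have h0 : ∀ (S : List (Fin P.n)) i, v.signUpProb S (some i) = 0 := by
        intro S i
        induction S with
        | nil => simp [InternalType.signUpProb]
        | cons j S ihS => simp [InternalType.signUpProb, ihS, hv]
      have h1 := v.sum_signUpProb (π h (.internal v)).1
      rw [Fintype.sum_option] at h1
      simp only [h0, Finset.sum_const_zero, add_zero] at h1
      simp only [expValue, Fintype.sum_option, Volunteer.signUpProb, h0, zero_mul,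
        Finset.sum_const_zero, add_zero, h1, one_mul]
      rw [ih _ fun v hv => hL v (List.mem_cons_of_mem _ hv)]
      simp [filled]

end Platform

/-! ### The competitive ratio -/

namespace Instance

variable (I : Instance)

lemma extArrivals_eq (i : Fin I.n) :
    I.extArrivals i = Platform.extTargets (P := I.toPlatform) I.arrivals i := by
  unfold extArrivals
  induction I.arrivals with
  | nil => rfl
  | cons v L ih =>
    rw [List.countP_cons, ih]
    cases v <;> simp only [Platform.extTargets, decide_eq_true_eq, Bool.false_eq_true, if_false,
      add_zero]

lemma cpr_le_mcpr {v : Volunteer I.n} (hv : v ∈ I.arrivals) : v.cpr ≤ I.mcpr := by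
  obtain ⟨t, rfl⟩ := List.mem_iff_get.1 hv
  exact le_ciSup (f := fun t : Fin I.arrivals.length => (I.arrivals.get t).cpr)
    (Set.finite_range _).bddAbove t

lemma bddAbove_expValue :
    BddAbove (Set.range fun π : I.toPlatform.Policy => I.toPlatform.expValue π [] I.arrivals) :=
  ⟨_, Set.forall_mem_range.2 fun π => Platform.expValue_le π I.arrivals⟩

lemma value_le_opt (alg : OnlineAlgorithm) : alg.value I ≤ I.opt :=
  le_ciSup I.bddAbove_expValue (alg I.toPlatform)

instance : Nonempty I.toPlatform.Policy := ⟨fun _ _ => ⟨[], List.nodup_nil, Nat.zero_le _⟩⟩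

lemma opt_le : I.opt ≤ ∑ i, (I.cap i : ℝ) :=
  ciSup_le fun π => Platform.expValue_le π I.arrivals

/-- A ratio of maximum to minimum below one can only be the default value `0` of volunteers who
never sign up; if all are such, OPT vanishes. -/
lemma one_le_of_mcpr_le {σ : ℝ} (h : I.mcpr ≤ σ) (hopt : 0 < I.opt) : 1 ≤ σ := by
  by_contra! hσ
  have h0 : ∀ v ∈ I.arrivals, ∀ i, v.μ i = 0 := fun v hv i =>
    Volunteer.μ_eq_zero_of_cpr_lt_one (((I.cpr_le_mcpr hv).trans h).trans_lt hσ) i (by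
      cases v with
      | external j => simp only [Volunteer.μ]; split_ifs <;> norm_num
      | internal v => exact v.μ_nonneg i)
  refine hopt.ne' ?_
  have : ∀ π : I.toPlatform.Policy, I.toPlatform.expValue π [] I.arrivals = 0 := fun π =>
    (Platform.expValue_eq_filled π I.arrivals [] h0).trans (by simp [Platform.filled])
  unfold opt
  simp [this]

/-- The key inequality with the value of the optimal policy. -/
lemma key_inequality_opt {alg : OnlineAlgorithm} (halg : IsACR alg) {α a b γ σ : ℝ}
    (ha : 0 ≤ a) (hb : b ≤ 0) (hg : ∀ p ∈ triangle, α + a * p.1 + b * p.2 ≤ g p) (hγ0 : 0 ≤ γ)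
    (hγ : ∀ i, γ ≤ Real.exp (-1 / (I.cap i : ℝ))) (hσ : I.mcpr ≤ σ) :
    0 ≤ (1 - γ * a) * alg.value I
        + (γ * (a - b) * σ - γ * (1 - 1 / Real.exp 1)) * I.opt
        + (γ * (1 - 1 / Real.exp 1) * (∑ i, (I.cap i : ℝ)) - γ * α * ∑ i, (I.cap i : ℝ)
          - γ * (a - b) * σ * ∑ i, ((min (I.cap i) (I.extArrivals i) : ℕ) : ℝ)) := by
  -- The coefficient of the benchmark has no definite sign, so the passage from policies to their
  -- supremum goes through closedness instead of monotonicity.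
  have hmem := csSup_mem_closure (Set.range_nonempty
    fun π : I.toPlatform.Policy => I.toPlatform.expValue π [] I.arrivals) I.bddAbove_expValue
  set A := (1 - γ * a) * alg.value I
  set κ := γ * (a - b) * σ - γ * (1 - 1 / Real.exp 1)
  set D := γ * (1 - 1 / Real.exp 1) * (∑ i, (I.cap i : ℝ)) - γ * α * ∑ i, (I.cap i : ℝ)
          - γ * (a - b) * σ * ∑ i, ((min (I.cap i) (I.extArrivals i) : ℕ) : ℝ) with hD
  have hcl : IsClosed {x : ℝ | 0 ≤ A + κ * x + D} :=
    isClosed_le continuous_const (by fun_prop)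
  refine hcl.closure_subset_iff.2 ?_ hmem
  rintro _ ⟨π, rfl⟩
  have := Platform.key_inequality halg π ha hb hg hγ0 hγ I.arrivals
    fun v hv => (I.cpr_le_mcpr hv).trans hσ
  simp only [← extArrivals_eq] at this
  exact this

end Instance

/-- The bound on the ratio given by an affine minorant of `g`. -/
lemma affine_le_ratio {α a b γ σ β z V O C : ℝ} (ha : 0 ≤ a) (hb : b ≤ 0) (hγ0 : 0 ≤ γ)
    (hO : 0 < O) (hOC : O ≤ C) (hz : V = z * O) (hz1 : z ≤ 1) (hσ : 1 ≤ σ)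
    (hβ : 0 ≤ β) (hbase : γ * (1 - 1 / Real.exp 1) ≤ z)
    (hkey : 0 ≤ (1 - γ * a) * V + (γ * (a - b) * σ - γ * (1 - 1 / Real.exp 1)) * O
        + (γ * (1 - 1 / Real.exp 1) * C - γ * α * C - γ * (a - b) * σ * (β * C))) :
    γ * (α + a * (β - σ + z) + b * (σ - β)) ≤ z := by
  subst hz
  have hC : 0 < C := hO.trans_le hOC
  -- `h1` and `h3` handle the terms in `C - O`: they reduce the case `O < C` to the inequality with
  -- `O = C`. `h4` then replaces `σ β` by `β`.
  have h1 := mul_le_mul_of_nonneg_right hbase (sub_nonneg.2 hOC)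
  have h2 : a * z ≤ (a - b) * σ := by
    have e1 : a * z ≤ a * σ := mul_le_mul_of_nonneg_left (hz1.trans hσ) ha
    have e2 : 0 ≤ -b * σ := mul_nonneg (by linarith) (by linarith)
    linarith
  have h3 := mul_le_mul_of_nonneg_left (mul_le_mul_of_nonneg_right h2 (sub_nonneg.2 hOC)) hγ0
  have h4 : 0 ≤ γ * ((a - b) * (β * C * (σ - 1))) :=
    mul_nonneg hγ0 (mul_nonneg (by linarith) (mul_nonneg (by positivity) (by linarith)))
  refine le_of_mul_le_mul_right ?_ hC
  linarith

lemma bound_le_ratio {alg : OnlineAlgorithm} (halg : IsACR alg) (I : Instance) {σ : ℝ}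
    (hσ : I.mcpr ≤ σ) (hopt : 0 < I.opt) :
    bound I.efet I.minCap σ ≤ alg.value I / I.opt := by
  have hσ1 := I.one_le_of_mcpr_le hσ hopt
  have hVO := I.value_le_opt alg
  have hOC := I.opt_le
  have hXV : ∑ i, ((min (I.cap i) (I.extArrivals i) : ℕ) : ℝ) ≤ alg.value I := by
    have := Platform.le_expValue (alg I.toPlatform) I.arrivals
    simp only [← Instance.extArrivals_eq] at this
    exact this
  have hX0 : 0 ≤ ∑ i, ((min (I.cap i) (I.extArrivals i) : ℕ) : ℝ) :=
    Finset.sum_nonneg fun i _ => Nat.cast_nonneg _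
  have hC : 0 < ∑ i, (I.cap i : ℝ) := hopt.trans_le hOC
  set γ := Real.exp (-1 / (I.minCap : ℝ)) with hγdef
  have hγ0 : 0 < γ := Real.exp_pos _
  have hγ1 : γ ≤ 1 := Real.exp_le_one_iff.2 (by rw [neg_div]; exact neg_nonpos.2 (by positivity))
  have hγ : ∀ i, γ ≤ Real.exp (-1 / (I.cap i : ℝ)) := by
    intro i
    have : Nonempty (Fin I.n) := ⟨i⟩
    have h1 : I.minCap ≤ I.cap i := ciInf_le (OrderBot.bddBelow _) i
    have h2 : 0 < I.minCap := by
      obtain ⟨j, hj⟩ := ciInf_mem I.cap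
      unfold Instance.minCap
      rw [← hj]
      exact I.cap_pos j
    rw [hγdef, Real.exp_le_exp, neg_div, neg_div, neg_le_neg_iff]
    gcongr
  have hkey : ∀ {α a b : ℝ}, 0 ≤ a → b ≤ 0 →
      (∀ p ∈ triangle, α + a * p.1 + b * p.2 ≤ g p) →
      0 ≤ (1 - γ * a) * alg.value I + (γ * (a - b) * σ - γ * (1 - 1 / Real.exp 1)) * I.opt
        + (γ * (1 - 1 / Real.exp 1) * (∑ i, (I.cap i : ℝ)) - γ * α * (∑ i, (I.cap i : ℝ))
          - γ * (a - b) * σ * (I.efet * ∑ i, (I.cap i : ℝ))) := by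
    intro α a b ha hb hg
    have := I.key_inequality_opt halg ha hb hg hγ0.le hγ hσ
    have he : I.efet * ∑ i, (I.cap i : ℝ) = ∑ i, ((min (I.cap i) (I.extArrivals i) : ℕ) : ℝ) :=
      div_mul_cancel₀ _ hC.ne'
    rw [he]
    exact this
  have hβ0 : 0 ≤ I.efet := div_nonneg hX0 hC.le
  have hβ1 : I.efet ≤ 1 := (div_le_one hC).2 (hXV.trans (hVO.trans hOC))
  have hβz : I.efet ≤ alg.value I / I.opt :=
    div_le_div₀ (hX0.trans hXV) hXV hopt hOC
  set z := alg.value I / I.opt with hz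
  have hzV : alg.value I = z * I.opt := (div_mul_cancel₀ _ hopt.ne').symm
  have hz0 : 0 ≤ z := hβ0.trans hβz
  have hz1 : z ≤ 1 := (div_le_one hopt).2 hVO
  -- The constant minorant `1 - 1/e` of `g` suffices for the first constraint.
  have hbase : γ * (1 - 1 / Real.exp 1) ≤ z := by
    have := hkey (α := 1 - 1 / Real.exp 1) (a := 0) (b := 0) le_rfl le_rfl
      (fun p hp => by simpa using le_g hp)
    rw [hz, le_div_iff₀ hopt]
    linarith
  refine max_le hβz (csInf_le ⟨0, fun _ h => h.1.1⟩ ⟨⟨hz0, hz1⟩, hbase, ?_⟩)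
  rw [← hγdef, ← le_div_iff₀' hγ0]
  refine Real.sSup_le ?_ (div_nonneg hz0 hγ0.le)
  rintro _ ⟨k, hk, hkg, rfl⟩
  rw [le_div_iff₀' hγ0]
  -- Supporting affine functions exist only at interior points. The edge `x₁ = 0` follows from
  -- `hbase`, and the hypotenuse, reached when `z = 1`, from `g ≤ 1`.
  rcases le_or_gt (I.efet - σ + z) 0 with hy | hy
  · rw [max_eq_left hy, sub_zero]
    have := hkg (0, z) ⟨le_rfl, hz0, by simpa using hz1⟩
    rw [g_zero_left] at this
    exact (mul_le_mul_of_nonneg_left this hγ0.le).trans hbase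
  rw [max_eq_right hy.le, show z - (I.efet - σ + z) = σ - I.efet by ring]
  have hT : (I.efet - σ + z, σ - I.efet) ∈ triangle :=
    ⟨hy.le, by simp only; linarith, by simp only; linarith⟩
  rcases hz1.eq_or_lt with h1 | h1
  · have := (hkg _ hT).trans (g_le_one hT)
    exact (mul_le_mul_of_nonneg_left this hγ0.le).trans (by linarith)
  obtain ⟨α₀, a₀, b₀, hmin, hky⟩ := exists_affine_minorant hk
    (y := (I.efet - σ + z, σ - I.efet)) hy (by simp only; linarith) (by simp only; linarith)
  obtain ⟨α, a, b, ha, hb, hg, hle⟩ := exists_monotone_affine_minorant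
    fun p hp => (hmin p hp).trans (hkg p hp)
  rw [hky]
  exact (mul_le_mul_of_nonneg_left (hle _ hT) hγ0.le).trans
    (affine_le_ratio ha hb hγ0.le hopt hOC hzV hz1 hσ1 hβ0 hbase (hkey ha hb hg))

end CascadeRanking

end

theorem mainTheorem9 (alg : CascadeRanking.OnlineAlgorithm) (halg : CascadeRanking.IsACR alg)
    (β : ℝ) (c : ℕ) (σ : ℝ) :
    ((CascadeRanking.bound β c σ : ℝ) : EReal) ≤
      CascadeRanking.compRatio alg (CascadeRanking.instanceClass β c σ) := by
  refine le_iInf fun I => le_iInf fun hI => le_iInf fun hopt => ?_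
  obtain ⟨rfl, rfl, hσ⟩ := hI
  exact EReal.coe_le_coe_iff.2 (CascadeRanking.bound_le_ratio halg I hσ hopt)
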